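/- Let $n\ge 1$, let $\gamma_0<\gamma_1<\dots<\gamma_{n-1}$ be real numbers and write $[n]=\{0,\dots,n-1\}$. Let the outcome $Y$ and the potential outcomes $Y^{(d,z)}$ ($d,z\in\{0,1\}$) take values in $\{\gamma_0,\dots,\gamma_{n-1}\}$, and let the treatment $D$ and the instrument $Z$ take values in $\{0,1\}$, all on one probability space; the joint law of these variables is called a full data law, and $\mathcal P=\mathcal L(Y,D,Z)$ is its observed law. Consider the model given by 1. exclusion: $Y^{(d,0)}=Y^{(d,1)}$ almost surely for $d\in\{0,1\}$; the common value is denoted $Y^{(d)}$; 2. joint independence: $Z$ is independent of the pair $(Y^{(0)},Y^{(1)})$; 3. outcome consistency: $Y=(1-D)Y^{(0)}+DY^{(1)}$ almost surely. No potential treatments $D^{(z)}$ are assumed to exist. Put $ATE=\mathbb E[Y^{(1)}-Y^{(0)}]$. For an observed law $\mathcal P$ with $\mathcal P(Z=z)>0$ for both $z$, let $p_{yd,z}=\mathcal P(Y=\gamma_y,D=d\mid Z=z)$, and let $\bar p_{yd,z}=p_{y(1-d),z}$ be the corresponding probabilities of the conjugate law $\bar{\mathcal P}(Y=y,D=d,Z=z)=\mathcal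 P(Y=y,D=1-d,Z=z)$. A binary array $B=(B_{ydz})_{y\in[n],\,d,z\in\{0,1\}}$ is called an admissible signature, with constant $\alpha=\alpha(B)$, if one of the following holds. - ($S_1$) There is $t$ with $0\le t<n-1$ such that $B_{i00}=B_{i01}=1$ for $i\ge t$ and $B_{i00}\ne B_{i01}$ for $i<t$; $B_{i10}\neq B_{i11}$ for all $i$; and $B_{i10}=B_{j11}=1$ for some $i,j$. Then $\alpha=-\gamma_0-\gamma_t$. - ($S_2$) $B_{(n-1)00}=B_{(n-1)01}=B_{010}=B_{011}=1$; $B_{i00}\ne B_{i01}$ for $i<n-1$; $B_{j10}\ne B_{j11}$ for $j>0$. Then $\alpha=-\gamma_0-\gamma_{n-1}$. - ($S_3$) There is $t$ with $0<t\le n-1$ such that $B_{i10}=B_{i11}=1$ for $i\le t$ and $B_{i10}\ne B_{i11}$ for $i>t$; $B_{i00}\ne B_{i01}$ for all $i$; and $B_{i00}=B_{j01}=1$ for some $i,j$. Then $\alpha=-\gamma_t-\gamma_{n-1}$. (At most one case applies to a given $B$, with a unique $t$.) For an admissible $B$ let $u(B)=(u_{ydz})$ be given by $u_{i00}=-\gamma_i-\alpha$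 if $B_{i00}=1$ and $\gamma_0$ otherwise; $u_{i10}=\gamma_i$ if $B_{i10}=1$ and $-\gamma_{n-1}-\alpha$ otherwise; $u_{i01}=-\gamma_i$ if $B_{i01}=1$ and $\gamma_0+\alpha$ otherwise; $u_{i11}=\gamma_i+\alpha$ if $B_{i11}=1$ and $-\gamma_{n-1}$ otherwise. Let $\mathcal V$ be the (finite, nonempty) set of all $u(B)$, write $v^\top p=\sum_{y,d,z}v_{ydz}\,p_{yd,z}$, and set $$L(\mathcal P)=\max_{v\in\mathcal V}v^\top p,\qquad U(\mathcal P)=-\max_{v\in\mathcal V}v^\top\bar p .$$ Theorem. The bounds $L(\mathcal P)\le ATE\le U(\mathcal P)$ are valid and sharp in the model 1–3. That is, (i) every full data law satisfying 1–3 with observed law $\mathcal P$ satisfies $L(\mathcal P)\le ATE\le U(\mathcal P)$; and (ii) for every $\mathcal P$ that is the observed law of some full data law satisfying 1–3, there are full data laws satisfying 1–3 with observed law $\mathcal P$ for which $ATE=L(\mathcal P)$ and $ATE=U(\mathcal P)$, respectively. -/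

import Mathlib

open MeasureTheory ProbabilityTheory

universe u

namespace BinaryIV

/-- The variables of the instrumental variable model with binary treatment, binary instrument and
outcome support `{γ 0, …, γ (n - 1)}`, on a common probability space: the potential outcomes
`pot d z = Y^(d,z)`, the observed treatment `D`, instrument `Z` and outcome `Y`.
No potential treatments `D^(z)` are part of the data. -/
structure FullData {n : ℕ} (γ : Fin n → ℝ) where
  /-- The sample space. -/
  Ω : Type u
  /-- Its σ-algebra. -/
  mΩ : MeasurableSpace Ω
  /-- The underlying probability measure. -/
  μ : Measure Ω
  isProb : IsProbabilityMeasure μ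
  /-- The potential outcomes `Y^(d,z)`. -/
  pot : Fin 2 → Fin 2 → Ω → ℝ
  /-- The treatment. -/
  D : Ω → Fin 2
  /-- The instrument. -/
  Z : Ω → Fin 2
  /-- The observed outcome. -/
  Y : Ω → ℝ
  measurable_pot : ∀ d z, Measurable (pot d z)
  measurable_D : Measurable D
  measurable_Z : Measurable Z
  measurable_Y : Measurable Y
  pot_mem : ∀ d z ω, pot d z ω ∈ Set.range γ
  Y_mem : ∀ ω, Y ω ∈ Set.range γ

attribute [instance] FullData.mΩ FullData.isProb

namespace FullData

variable {n : ℕ} {γ : Fin n → ℝ}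

/-- Individual-level exclusion: `Y^(d,z) = Y^(d,z')` almost surely. -/
def Exclusion (M : FullData.{u} γ) : Prop :=
  ∀ d z z', M.pot d z =ᵐ[M.μ] M.pot d z'

/-- The potential outcome `Y^(d)`; under exclusion the choice of `z = 0` is immaterial. -/
def potY (M : FullData.{u} γ) (d : Fin 2) : M.Ω → ℝ := M.pot d 0

/-- Joint independence: `Z` is independent of the pair `(Y^(0), Y^(1))`. -/
def JointIndependence (M : FullData.{u} γ) : Prop :=
  IndepFun M.Z (fun ω => (M.potY 0 ω, M.potY 1 ω)) M.μ

/-- Outcome consistency: `Y = (1 - D) Y^(0) + D Y^(1)` almost surely. -/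
def OutcomeConsistency (M : FullData.{u} γ) : Prop :=
  ∀ᵐ ω ∂M.μ, M.Y ω = (1 - ((M.D ω : ℕ) : ℝ)) * M.potY 0 ω + ((M.D ω : ℕ) : ℝ) * M.potY 1 ω

/-- The model given by exclusion, joint independence and outcome consistency. -/
def IsJointIV (M : FullData.{u} γ) : Prop :=
  M.Exclusion ∧ M.JointIndependence ∧ M.OutcomeConsistency

/-- The observed data law, the law of `(Y, D, Z)`. -/
noncomputable def observedLaw (M : FullData.{u} γ) : Measure (ℝ × Fin 2 × Fin 2) :=
  M.μ.map (fun ω => (M.Y ω, M.D ω, M.Z ω))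

/-- The average treatment effect `E[Y^(1) - Y^(0)]`. -/
noncomputable def ate (M : FullData.{u} γ) : ℝ :=
  ∫ ω, (M.potY 1 ω - M.potY 0 ω) ∂M.μ

end FullData

/-- The largest index `n - 1`. -/
def lastIdx (n : ℕ) [NeZero n] : Fin n := ⟨n - 1, Nat.sub_one_lt (NeZero.ne n)⟩

section Signatures

variable {n : ℕ} [NeZero n]

/-- Signatures of the first kind, with index `0 ≤ t < n - 1`;
`B y d z` is the entry of the binary vector `B` at `(y, d, z)`. -/
def IsS1 (t : Fin n) (B : Fin n → Fin 2 → Fin 2 → Bool) : Prop :=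
  t < lastIdx n ∧
  (∀ i, t ≤ i → B i 0 0 = true ∧ B i 0 1 = true) ∧
  (∀ i, i < t → B i 0 0 ≠ B i 0 1) ∧
  (∀ i, B i 1 0 ≠ B i 1 1) ∧
  (∃ i, B i 1 0 = true) ∧ (∃ j, B j 1 1 = true)

/-- Signatures of the second kind. -/
def IsS2 (B : Fin n → Fin 2 → Fin 2 → Bool) : Prop :=
  (B (lastIdx n) 0 0 = true ∧ B (lastIdx n) 0 1 = true ∧ B 0 1 0 = true ∧ B 0 1 1 = true) ∧
  (∀ i, i < lastIdx n → B i 0 0 ≠ B i 0 1) ∧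
  (∀ j, 0 < j → B j 1 0 ≠ B j 1 1)

/-- Signatures of the third kind, with index `0 < t ≤ n - 1`. -/
def IsS3 (t : Fin n) (B : Fin n → Fin 2 → Fin 2 → Bool) : Prop :=
  0 < t ∧
  (∀ i, i ≤ t → B i 1 0 = true ∧ B i 1 1 = true) ∧
  (∀ i, t < i → B i 1 0 ≠ B i 1 1) ∧
  (∀ i, B i 0 0 ≠ B i 0 1) ∧
  (∃ i, B i 0 0 = true) ∧ (∃ j, B j 0 1 = true)

/-- `B` is an admissible signature and `α` is the constant attached to it. (For a given `B` exactly
one of the three cases applies, with a unique `t`.) -/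
def AdmissibleWith (γ : Fin n → ℝ) (B : Fin n → Fin 2 → Fin 2 → Bool) (α : ℝ) : Prop :=
  (∃ t, IsS1 t B ∧ α = -γ 0 - γ t) ∨
  (IsS2 B ∧ α = -γ 0 - γ (lastIdx n)) ∨
  (∃ t, IsS3 t B ∧ α = -γ t - γ (lastIdx n))

/-- The vector `u(B)`, with entry `u_{ydz}` at `y d z`. -/
noncomputable def vertexMap (γ : Fin n → ℝ) (α : ℝ) (B : Fin n → Fin 2 → Fin 2 → Bool) :
    Fin n → Fin 2 → Fin 2 → ℝ := fun i =>
  ![![if B i 0 0 then -γ i - α else γ 0,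
      if B i 0 1 then -γ i else γ 0 + α],
    ![if B i 1 0 then γ i else -γ (lastIdx n) - α,
      if B i 1 1 then γ i + α else -γ (lastIdx n)]]

/-- The set `𝒱` of the vectors `u(B)`, over all admissible signatures `B`. -/
def vertexSet (γ : Fin n → ℝ) : Set (Fin n → Fin 2 → Fin 2 → ℝ) :=
  {v | ∃ B α, AdmissibleWith γ B α ∧ v = vertexMap γ α B}

theorem vertexSet_finite (γ : Fin n → ℝ) : (vertexSet γ).Finite := by
  refine (Set.finite_range (fun x : (Fin n → Fin 2 → Fin 2 → Bool) × Fin n × Fin n =>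
    vertexMap γ (-γ x.2.1 - γ x.2.2) x.1)).subset ?_
  rintro v ⟨B, α, ⟨t, -, rfl⟩ | ⟨-, rfl⟩ | ⟨t, -, rfl⟩, rfl⟩
  · exact ⟨(B, 0, t), rfl⟩
  · exact ⟨(B, 0, lastIdx n), rfl⟩
  · exact ⟨(B, t, lastIdx n), rfl⟩

theorem vertexSet_nonempty (γ : Fin n → ℝ) : (vertexSet γ).Nonempty := by
  classical
  refine ⟨_, fun i d z => if z = 0 then true else if d = 0 then decide (i = lastIdx n)
    else decide (i = 0), _, Or.inr (Or.inl ⟨⟨by simp, ?_, ?_⟩, rfl⟩), rfl⟩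
  · intro i hi
    simp [hi.ne]
  · intro j hj
    simp [hj.ne']

/-- The pairing `vᵀp = ∑_{y,d,z} v_{ydz} p_{ydz}`. -/
def dot (v p : Fin n → Fin 2 → Fin 2 → ℝ) : ℝ := ∑ y, ∑ d, ∑ z, v y d z * p y d z

/-- The conditional probabilities `p_{yd,z} = P(Y = γ_y, D = d ∣ Z = z)`. -/
noncomputable def condProbs (γ : Fin n → ℝ) (P : Measure (ℝ × Fin 2 × Fin 2)) :
    Fin n → Fin 2 → Fin 2 → ℝ := fun y d z =>
  (ProbabilityTheory.cond P {w | w.2.2 = z}).real {w | w.1 = γ y ∧ w.2.1 = d}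

/-- The conjugate law: `conj P (Y = y, D = d, Z = z) = P (Y = y, D = 1 - d, Z = z)`. -/
noncomputable def conjLaw (P : Measure (ℝ × Fin 2 × Fin 2)) : Measure (ℝ × Fin 2 × Fin 2) :=
  P.map (fun w => (w.1, 1 - w.2.1, w.2.2))

/-- `max_{v ∈ 𝒱} vᵀp`, for a vector `p`. -/
noncomputable def maxVertex (γ : Fin n → ℝ) (p : Fin n → Fin 2 → Fin 2 → ℝ) : ℝ :=
  sSup ((fun v => dot v p) '' vertexSet γ)

/-- The supremum defining `maxVertex` is a maximum. -/
theorem maxVertex_isGreatest (γ : Fin n → ℝ) (p : Fin n → Fin 2 → Fin 2 → ℝ) :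
    IsGreatest ((fun v => dot v p) '' vertexSet γ) (maxVertex γ p) := by
  have hf := (vertexSet_finite γ).image (fun v => dot v p)
  exact ⟨((vertexSet_nonempty γ).image _).csSup_mem hf,
    fun _ hx => le_csSup hf.bddAbove hx⟩

/-- The lower bound `L(P) = max_{v ∈ 𝒱} vᵀp`. -/
noncomputable def lowerBound (γ : Fin n → ℝ) (P : Measure (ℝ × Fin 2 × Fin 2)) : ℝ :=
  maxVertex γ (condProbs γ P)

/-- The upper bound `U(P) = - max_{v ∈ 𝒱} vᵀp̄`, with `p̄` the vector of the conjugate law. -/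
noncomputable def upperBound (γ : Fin n → ℝ) (P : Measure (ℝ × Fin 2 × Fin 2)) : ℝ :=
  -maxVertex γ (condProbs γ (conjLaw P))

end Signatures

end BinaryIV

universe v

/-! Given `Z = z`, let `r i j d z` be the conditional joint law of `(Y^(0), Y^(1), D)`. The model
amounts to linear constraints on `r`, with the ATE a linear functional of it, and every feasible `r`
comes from a full data law on a finite space (`IsCoupling.exists_fullData`). So the sharp lower
bound is the value of a linear programme, which duality turns into a maximum of `dot u p` over
`IsDualFeasible` vectors `u`.

The cross constraints on `u` say that `u i 0 0 + γ i` never exceeds `γ j - u j 1 1`, and similarly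
for the other pair, so each pair can be separated by a level. As both conditional laws have mass
one, only the sum of the two levels matters; call it `-α`. For fixed `α` the dual splits into one
problem per outcome and arm: two entries have individual caps and a cap on their sum, and any excess
is removed at least cost from the entry with the smaller probability. The resulting value is
`dualProfile γ p α`, attained at a vector of the form `u(B)`.

In `α` this value is piecewise linear, with knots exactly at the constants of the admissible
signatures. Feasibility of the primal makes the slopes at both ends point towards the knots
(`IsCoupling.sum_control_le`, `IsCoupling.sum_treated_le`), so some knot is optimal. If the
existence clauses of S1 or S3 fail there, the profile is monotone on that side and the central knot,
of type S2, does at least as well. The upper bound follows by exchanging the two treatment arms,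
which negates the ATE. -/

namespace BinaryIV

/-! ### Two general tools: finite linear programming duality and piecewise linear functions. -/

/-- Linear programming duality for a programme whose feasible points have fixed total mass `S`:
if `θ` is below every primal value and above every dual value, then it is a primal value. -/
theorem exists_primal_eq_of_dual_le {J K : Type*} [Fintype J] [Fintype K]
    (A : K → J → ℝ) (b : K → ℝ) (c : J → ℝ) (θ S : ℝ) (e : K → ℝ) (hS : 0 < S)
    (he : ∀ j, ∑ k, e k * A k j = 1) (heb : ∑ k, e k * b k = S)
    (x₀ : J → ℝ) (hx₀ : ∀ j, 0 ≤ x₀ j) (hAx₀ : ∀ k, ∑ j, A k j * x₀ j = b k)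
    (hweak : θ ≤ ∑ j, c j * x₀ j)
    (hdual : ∀ u : K → ℝ, (∀ j, ∑ k, u k * A k j ≤ c j) → ∑ k, u k * b k ≤ θ) :
    ∃ x : J → ℝ, (∀ j, 0 ≤ x j) ∧ (∀ k, ∑ j, A k j * x j = b k) ∧ ∑ j, c j * x j = θ := by
  classical
  by_contra hcon
  have hsum : ∀ x : J → ℝ, (∀ k, ∑ j, A k j * x j = b k) → ∑ j, x j = S := by
    intro x hx
    rw [← heb]
    simp_rw [← hx, Finset.mul_sum]
    rw [Finset.sum_comm]
    refine Finset.sum_congr rfl fun j _ => ?_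
    have := congrArg (· * x j) (he j)
    simpa [Finset.sum_mul, mul_assoc] using this.symm
  have hlt : θ < ∑ j, c j * x₀ j := by
    refine lt_of_le_of_ne hweak fun h => hcon ⟨x₀, hx₀, hAx₀, h.symm⟩
  -- Fixed total mass lets the simplex replace the cone of nonnegative vectors: its image is compact
  -- and convex, so a point outside it can be strictly separated.
  let L : (J → ℝ) →ₗ[ℝ] (K → ℝ) × ℝ :=
    (Matrix.mulVecLin (Matrix.of A)).prod (dotProductBilin ℝ ℝ c)
  have hL : ∀ x, L x = (fun k => ∑ j, A k j * x j, ∑ j, c j * x j) := fun x => rfl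
  have hcomp : IsCompact (L '' stdSimplex ℝ J) :=
    (isCompact_stdSimplex ℝ J).image (LinearMap.continuous_of_finiteDimensional L)
  have hconv : Convex ℝ (L '' stdSimplex ℝ J) := (convex_stdSimplex ℝ J).linear_image L
  have hnot : (S⁻¹ • (b, θ) : (K → ℝ) × ℝ) ∉ L '' stdSimplex ℝ J := by
    rintro ⟨x, ⟨hx0, hx1⟩, hx⟩
    apply hcon
    have h2 : L (S • x) = (b, θ) := by
      rw [map_smul, hx, smul_smul, mul_inv_cancel₀ hS.ne', one_smul]
    rw [hL] at h2
    exact ⟨S • x, fun j => mul_nonneg hS.le (hx0 j),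
      fun k => congrFun (congrArg Prod.fst h2) k, congrArg Prod.snd h2⟩
  obtain ⟨f, m, hfm, hmf⟩ :=
    geometric_hahn_banach_closed_point hconv hcomp.isClosed hnot
  set w : K → ℝ := fun k => f (Pi.single k 1, 0) with hw
  set l : ℝ := f (0, 1) with hl
  have hf : ∀ y s, f (y, s) = ∑ k, w k * y k + l * s := by
    intro y s
    have h1 : (y, s) = ∑ k, y k • ((Pi.single k 1, 0) : (K → ℝ) × ℝ)
        + s • ((0, 1) : (K → ℝ) × ℝ) := by
      ext k
      · simp [Prod.fst_sum, Finset.sum_apply, Pi.single_apply]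
      · simp [Prod.snd_sum]
    rw [h1, map_add, map_sum]
    simp only [map_smul, smul_eq_mul, hw, hl]
    simp [mul_comm]
  have hm : ∀ j, ∑ k, w k * A k j + l * c j < m := by
    intro j
    have := hfm _ ⟨Pi.single j 1, single_mem_stdSimplex ℝ j, rfl⟩
    rw [hL, hf] at this
    simpa [Pi.single_apply] using this
  rw [map_smul, hf, smul_eq_mul, lt_inv_mul_iff₀ hS] at hmf
  -- The image of `x₀` shares its first component with the separated point and has a larger second
  -- one, which fixes the sign of `l`.
  have hl0 : l < 0 := by
    have h1 : f (b, ∑ j, c j * x₀ j) ≤ S * m := by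
      rw [hf]
      have h3 : ∑ k, w k * b k + l * ∑ j, c j * x₀ j
          = ∑ j, (∑ k, w k * A k j + l * c j) * x₀ j := by
        simp_rw [← hAx₀, add_mul, Finset.sum_add_distrib, Finset.mul_sum, Finset.sum_mul]
        rw [Finset.sum_comm]
        simp only [mul_assoc]
      rw [h3, ← hsum x₀ hAx₀, Finset.sum_mul]
      refine Finset.sum_le_sum fun j _ => ?_
      rw [mul_comm (x₀ j)]
      exact mul_le_mul_of_nonneg_right (hm j).le (hx₀ j)
    rw [hf] at h1
    by_contra hcl
    push Not at hcl
    nlinarith [mul_le_mul_of_nonneg_left hlt.le hcl]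
  -- Subtracting `m * e` absorbs the separation threshold into the functional, because `e` pairs to
  -- one with every column; dividing by `-l` then makes it dual feasible, with value above `θ`.
  have key := hdual (fun k => (w k - m * e k) / (-l)) (by
    intro j
    have : ∑ k, (w k - m * e k) / (-l) * A k j
        = (∑ k, w k * A k j - m * ∑ k, e k * A k j) / (-l) := by
      rw [Finset.mul_sum, ← Finset.sum_sub_distrib, Finset.sum_div]
      exact Finset.sum_congr rfl fun k _ => by ring
    rw [this, he, div_le_iff₀ (by linarith)]
    nlinarith [hm j])
  have h4 : ∑ k, (w k - m * e k) / (-l) * b k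
      = (∑ k, w k * b k - m * ∑ k, e k * b k) / (-l) := by
    rw [Finset.mul_sum, ← Finset.sum_sub_distrib, Finset.sum_div]
    exact Finset.sum_congr rfl fun k _ => by ring
  rw [h4, heb, div_le_iff₀ (by linarith)] at key
  nlinarith

/-- A piecewise linear function of the shape below, with nonpositive slope at `∞`, is bounded, to the
right of a knot, by its values at the knots. -/
theorem exists_knot_ge {ι : Type*} [Fintype ι] (x m : ι → ℝ) (κ α : ℝ)
    (hκ : κ ≤ 0) (i₀ : ι) (hα : x i₀ ≤ α) :
    ∃ t, x i₀ ≤ x t ∧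
      κ * α - ∑ i, max (x i - α) 0 * m i ≤ κ * x t - ∑ i, max (x i - x t) 0 * m i := by
  classical
  -- As long as no knot lies strictly between `α` and `β`, the change is displacement times the
  -- slope just right of `α`. Move to the nearest knot on the left if that slope is nonpositive, on
  -- the right otherwise; a right one exists because beyond all knots the slope is `κ ≤ 0`.
  have diff : ∀ β, (∀ i, max (x i - β) 0 - max (x i - α) 0 = if α < x i then α - β else 0) →
      (κ * β - ∑ i, max (x i - β) 0 * m i) - (κ * α - ∑ i, max (x i - α) 0 * m i)
        = (β - α) * (κ + ∑ i, if α < x i then m i else 0) := by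
    intro β hβ
    have h1 : ∑ i, max (x i - β) 0 * m i - ∑ i, max (x i - α) 0 * m i
        = (α - β) * ∑ i, if α < x i then m i else 0 := by
      rw [← Finset.sum_sub_distrib, Finset.mul_sum]
      refine Finset.sum_congr rfl fun i _ => ?_
      rw [← sub_mul, hβ]
      split_ifs <;> simp
    linarith
  rcases le_or_gt (κ + ∑ i, if α < x i then m i else 0) 0 with hσ | hσ
  · obtain ⟨t, ht, htmax⟩ := Finset.exists_max_image (Finset.univ.filter fun i => x i ≤ α) x
      ⟨i₀, by simpa using hα⟩
    simp only [Finset.mem_filter, Finset.mem_univ, true_and] at ht htmax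
    refine ⟨t, htmax _ hα, ?_⟩
    have := diff (x t) (fun i => by
      split_ifs with h
      · rw [max_eq_left (by linarith), max_eq_left (by linarith)]; ring
      · have := htmax i (not_lt.mp h)
        rw [max_eq_right (by linarith), max_eq_right (by linarith)]; ring)
    nlinarith [mul_nonneg_of_nonpos_of_nonpos (sub_nonpos.mpr ht) hσ]
  · have hne : (Finset.univ.filter fun i => α < x i).Nonempty := by
      by_contra h
      rw [Finset.not_nonempty_iff_eq_empty, Finset.filter_eq_empty_iff] at h
      have : ∑ i, (if α < x i then m i else 0) = 0 :=
        Finset.sum_eq_zero fun i hi => if_neg (h hi)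
      linarith
    obtain ⟨t, ht, htmin⟩ := Finset.exists_min_image _ x hne
    simp only [Finset.mem_filter, Finset.mem_univ, true_and] at ht htmin
    refine ⟨t, by linarith, ?_⟩
    have := diff (x t) (fun i => by
      split_ifs with h
      · have := htmin i h
        rw [max_eq_left (by linarith), max_eq_left (by linarith)]; ring
      · rw [max_eq_right (by linarith), max_eq_right (by linarith)]; ring)
    nlinarith [mul_pos (sub_pos.mpr ht) hσ]

/-! ### The linear programme over couplings and its dual. -/

section Program

variable {n : ℕ}

/-- `r i j d z` are conditional probabilities `P(Y^(0) = γ i, Y^(1) = γ j, D = d ∣ Z = z)`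
compatible with the observed conditional probabilities `p`. -/
structure IsCoupling (p : Fin n → Fin 2 → Fin 2 → ℝ) (r : Fin n → Fin n → Fin 2 → Fin 2 → ℝ) :
    Prop where
  nonneg : ∀ i j d z, 0 ≤ r i j d z
  control : ∀ i z, ∑ j, r i j 0 z = p i 0 z
  treated : ∀ j z, ∑ i, r i j 1 z = p j 1 z
  indep : ∀ i j, r i j 0 0 + r i j 1 0 = r i j 0 1 + r i j 1 1

/-- The average treatment effect of a coupling. -/
def effect (γ : Fin n → ℝ) (r : Fin n → Fin n → Fin 2 → Fin 2 → ℝ) : ℝ :=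
  ∑ i, ∑ j, (γ j - γ i) * (r i j 0 0 + r i j 1 0)

/-- The constraints of the linear programme dual to minimizing `effect` over couplings. -/
structure IsDualFeasible (γ : Fin n → ℝ) (u : Fin n → Fin 2 → Fin 2 → ℝ) : Prop where
  control : ∀ i j, u i 0 0 + u i 0 1 ≤ γ j - γ i
  treated : ∀ i j, u j 1 0 + u j 1 1 ≤ γ j - γ i
  cross : ∀ i j, u i 0 0 + u j 1 1 ≤ γ j - γ i
  cross' : ∀ i j, u j 1 0 + u i 0 1 ≤ γ j - γ i

theorem dot_eq (v p : Fin n → Fin 2 → Fin 2 → ℝ) :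
    dot v p = ∑ i, (v i 0 0 * p i 0 0 + v i 0 1 * p i 0 1)
      + ∑ i, (v i 1 0 * p i 1 0 + v i 1 1 * p i 1 1) := by
  simp only [dot, Fin.sum_univ_two, Finset.sum_add_distrib]
  ring

/-- Weak duality. For fixed `(i, j)` and `z`, bound the two dual entries by their maximum over `d`;
it then multiplies a mass that does not depend on `z`, and the four constraints together bound the
sum of the two maxima. -/
theorem IsDualFeasible.dot_le {γ : Fin n → ℝ} {u p : Fin n → Fin 2 → Fin 2 → ℝ}
    {r : Fin n → Fin n → Fin 2 → Fin 2 → ℝ} (hu : IsDualFeasible γ u) (hr : IsCoupling p r) :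
    dot u p ≤ effect γ r := by
  have h : dot u p = ∑ i, ∑ j, (u i 0 0 * r i j 0 0 + u i 0 1 * r i j 0 1
      + (u j 1 0 * r i j 1 0 + u j 1 1 * r i j 1 1)) := by
    simp only [dot_eq, ← hr.control, ← hr.treated, Finset.mul_sum, Finset.sum_add_distrib]
    rw [Finset.sum_comm (f := fun i j => u i 1 0 * r j i 1 0),
      Finset.sum_comm (f := fun i j => u i 1 1 * r j i 1 1)]
  rw [h, effect]
  refine Finset.sum_le_sum fun i _ => Finset.sum_le_sum fun j _ => ?_
  have hq := hr.indep i j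
  have h00 := mul_le_mul_of_nonneg_right (le_max_left (u i 0 0) (u j 1 0)) (hr.nonneg i j 0 0)
  have h10 := mul_le_mul_of_nonneg_right (le_max_right (u i 0 0) (u j 1 0)) (hr.nonneg i j 1 0)
  have h01 := mul_le_mul_of_nonneg_right (le_max_left (u i 0 1) (u j 1 1)) (hr.nonneg i j 0 1)
  have h11 := mul_le_mul_of_nonneg_right (le_max_right (u i 0 1) (u j 1 1)) (hr.nonneg i j 1 1)
  have hmax : max (u i 0 0) (u j 1 0) + max (u i 0 1) (u j 1 1) ≤ γ j - γ i := by
    have := hu.control i j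
    have := hu.treated i j
    have := hu.cross i j
    have := hu.cross' i j
    rcases max_choice (u i 0 0) (u j 1 0) with h | h <;>
      rcases max_choice (u i 0 1) (u j 1 1) with h' | h' <;> rw [h, h'] <;> assumption
  have := mul_le_mul_of_nonneg_right hmax (add_nonneg (hr.nonneg i j 0 0) (hr.nonneg i j 1 0))
  have h5 : max (u i 0 1) (u j 1 1) * (r i j 0 0 + r i j 1 0)
    = max (u i 0 1) (u j 1 1) * (r i j 0 1 + r i j 1 1) := by rw [hq]
  linarith

/-- Strong duality: a number below the effect of some coupling and above all dual values is the
effect of a coupling. -/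
theorem IsCoupling.exists_effect_eq {γ : Fin n → ℝ} {p : Fin n → Fin 2 → Fin 2 → ℝ}
    {r₀ : Fin n → Fin n → Fin 2 → Fin 2 → ℝ} (hr₀ : IsCoupling p r₀)
    (hp : ∀ z, ∑ y, ∑ d, p y d z = 1) {θ : ℝ} (hθ : θ ≤ effect γ r₀)
    (hdual : ∀ u, IsDualFeasible γ u → dot u p ≤ θ) :
    ∃ r, IsCoupling p r ∧ effect γ r = θ := by
  classical
  let A : (Fin n × Fin 2 × Fin 2) ⊕ (Fin n × Fin n) → Fin n × Fin n × Fin 2 × Fin 2 → ℝ :=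
    fun k x => Sum.elim
      (fun a : Fin n × Fin 2 × Fin 2 =>
        if a = (if x.2.2.1 = 0 then x.1 else x.2.1, x.2.2.1, x.2.2.2) then (1 : ℝ) else 0)
      (fun a : Fin n × Fin n =>
        if a = (x.1, x.2.1) then (if x.2.2.2 = 0 then (1 : ℝ) else -1) else 0) k
  let b : (Fin n × Fin 2 × Fin 2) ⊕ (Fin n × Fin n) → ℝ :=
    Sum.elim (fun a => p a.1 a.2.1 a.2.2) (fun _ => 0)
  let c : Fin n × Fin n × Fin 2 × Fin 2 → ℝ :=
    fun x => if x.2.2.2 = 0 then γ x.2.1 - γ x.1 else 0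
  have hrow : ∀ x : Fin n × Fin n × Fin 2 × Fin 2 → ℝ, (∀ k, ∑ j, A k j * x j = b k) ↔
      (∀ i z, ∑ j, x (i, j, 0, z) = p i 0 z) ∧ (∀ j z, ∑ i, x (i, j, 1, z) = p j 1 z) ∧
      ∀ i j, x (i, j, 0, 0) + x (i, j, 1, 0) = x (i, j, 0, 1) + x (i, j, 1, 1) := by
    intro x
    have h0 : ∀ i z, ∑ j, A (Sum.inl (i, 0, z)) j * x j = ∑ j, x (i, j, 0, z) := by
      intro i z
      fin_cases z <;>
      simp [A, Fintype.sum_prod_type, Fin.sum_univ_two, ite_and]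
    have h1 : ∀ j z, ∑ k, A (Sum.inl (j, 1, z)) k * x k = ∑ i, x (i, j, 1, z) := by
      intro i z
      fin_cases z <;>
      simp [A, Fintype.sum_prod_type, Fin.sum_univ_two, ite_and]
    have h2 : ∀ i j, ∑ k, A (Sum.inr (i, j)) k * x k
        = x (i, j, 0, 0) + x (i, j, 1, 0) - (x (i, j, 0, 1) + x (i, j, 1, 1)) := by
      intro i j
      simp [A, Fintype.sum_prod_type, Fin.sum_univ_two, ite_and, Finset.sum_add_distrib,
        Finset.sum_ite_irrel]
      ring
    constructor
    · intro h
      refine ⟨fun i z => ?_, fun j z => ?_, fun i j => ?_⟩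
      · rw [← h0, h]; rfl
      · rw [← h1, h]; rfl
      · have := h2 i j
        rw [h] at this
        exact (sub_eq_zero.mp this.symm)
    · rintro ⟨g0, g1, g2⟩ (⟨y, d, z⟩ | ⟨i, j⟩)
      · fin_cases d
        · exact (h0 y z).trans (g0 y z)
        · exact (h1 y z).trans (g1 y z)
      · rw [h2, g2, sub_self]; rfl
  have hcol : ∀ (u : (Fin n × Fin 2 × Fin 2) ⊕ (Fin n × Fin n) → ℝ) i j d z,
      ∑ k, u k * A k (i, j, d, z) = u (Sum.inl (if d = 0 then i else j, d, z))
        + u (Sum.inr (i, j)) * (if z = 0 then 1 else -1) := by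
    intro u i j d z
    simp [A, Fintype.sum_sum_type]
  have hc : ∀ x : Fin n × Fin n × Fin 2 × Fin 2 → ℝ, ∑ j, c j * x j =
      effect γ fun i j d z => x (i, j, d, z) := by
    intro x
    simp [c, effect, Fintype.sum_prod_type, Fin.sum_univ_two, mul_add]
  have hb : ∀ u : (Fin n × Fin 2 × Fin 2) ⊕ (Fin n × Fin n) → ℝ, ∑ k, u k * b k =
      dot (fun y d z => u (Sum.inl (y, d, z))) p := by
    intro u
    simp [b, dot, Fintype.sum_sum_type, Fintype.sum_prod_type]
  -- The total mass is `2`, one unit per instrument value; the certificate is the indicator of the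
  -- observed-probability rows, since each column meets exactly one of them.
  obtain ⟨x, hx0, hx1, hx2⟩ := exists_primal_eq_of_dual_le A b c θ 2
    (Sum.elim (fun _ => 1) (fun _ => 0)) two_pos
    (by rintro ⟨i, j, d, z⟩; rw [hcol]; simp)
    (by
      rw [hb]
      have h0 := hp 0
      have h1 := hp 1
      simp only [Fin.sum_univ_two, Finset.sum_add_distrib] at h0 h1
      simp only [dot_eq, Sum.elim_inl, one_mul, Finset.sum_add_distrib]
      linarith)
    (fun x => r₀ x.1 x.2.1 x.2.2.1 x.2.2.2) (fun _ => hr₀.nonneg _ _ _ _)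
    ((hrow _).2 ⟨hr₀.control, hr₀.treated, hr₀.indep⟩) (by rw [hc]; exact hθ)
    (by
      intro u hu
      rw [hb]
      -- Adding a `z = 0` and a `z = 1` inequality with the same `(i, j)` cancels the multiplier of
      -- the independence row; the four choices of `d` give the four dual constraints.
      have hu' := fun i j d z => (hcol u i j d z).symm.trans_le (hu (i, j, d, z))
      refine hdual _ ⟨fun i j => ?_, fun i j => ?_, fun i j => ?_, fun i j => ?_⟩
      · have g0 := hu' i j 0 0
        have g1 := hu' i j 0 1
        simp [c] at g0 g1 ⊢
        linarith
      · have g0 := hu' i j 1 0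
        have g1 := hu' i j 1 1
        simp [c] at g0 g1 ⊢
        linarith
      · have g0 := hu' i j 0 0
        have g1 := hu' i j 1 1
        simp [c] at g0 g1 ⊢
        linarith
      · have g0 := hu' i j 1 0
        have g1 := hu' i j 0 1
        simp [c] at g0 g1 ⊢
        linarith)
  rw [hrow] at hx1
  exact ⟨fun i j d z => x (i, j, d, z), ⟨fun _ _ _ _ => hx0 _, hx1.1, hx1.2.1, hx1.2.2⟩,
    (hc x).symm.trans hx2⟩

end Program

/-! ### Optimal dual vectors at a fixed level `α`. -/

section Vertices

variable {n : ℕ} [NeZero n]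

theorem le_lastIdx (i : Fin n) : i ≤ lastIdx n := Fin.le_def.2 (Nat.le_sub_one_of_lt i.2)

/-- The maximal dual value with cross constraints split at level `α`. -/
noncomputable def dualProfile (γ : Fin n → ℝ) (p : Fin n → Fin 2 → Fin 2 → ℝ) (α : ℝ) : ℝ :=
  ∑ i, ((-γ i - α) * p i 0 0 - γ i * p i 0 1
      - max (-γ 0 - γ i - α) 0 * min (p i 0 0) (p i 0 1))
    + ∑ j, (γ j * p j 1 0 + (γ j + α) * p j 1 1
      - max (γ j + γ (lastIdx n) + α) 0 * min (p j 1 0) (p j 1 1))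

theorem AdmissibleWith.isDualFeasible {γ : Fin n → ℝ} (hγ : Monotone γ)
    {B : Fin n → Fin 2 → Fin 2 → Bool} {α : ℝ} (h : AdmissibleWith γ B α) :
    IsDualFeasible γ (vertexMap γ α B) := by
  have h0 : ∀ i, γ 0 ≤ γ i := fun i => hγ (Fin.zero_le i)
  have h1 : ∀ i, γ i ≤ γ (lastIdx n) := fun i => hγ (le_lastIdx i)
  -- In each pair, the excess of the two individual caps over the cap on their sum decides: if it is
  -- nonpositive both caps may be kept, and if it is nonnegative lowering one entry by the excess is
  -- enough.
  have key : (∀ i, (B i 0 0 = true ∧ B i 0 1 = true ∧ -γ 0 - γ i - α ≤ 0) ∨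
        (B i 0 0 ≠ B i 0 1 ∧ 0 ≤ -γ 0 - γ i - α)) ∧
      (∀ j, (B j 1 0 = true ∧ B j 1 1 = true ∧ γ j + γ (lastIdx n) + α ≤ 0) ∨
        (B j 1 0 ≠ B j 1 1 ∧ 0 ≤ γ j + γ (lastIdx n) + α)) := by
    rcases h with ⟨t, ⟨-, ha, hb, hc, -⟩, rfl⟩ | ⟨⟨⟨ha, ha', hb, hb'⟩, hc, hd⟩, rfl⟩ |
      ⟨t, ⟨-, ha, hb, hc, -⟩, rfl⟩
    · refine ⟨fun i => ?_, fun j => Or.inr ⟨hc j, by linarith [h0 j, h1 t]⟩⟩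
      rcases le_or_gt t i with hi | hi
      · exact Or.inl ⟨(ha i hi).1, (ha i hi).2, by linarith [hγ hi]⟩
      · exact Or.inr ⟨hb i hi, by linarith [hγ hi.le]⟩
    · refine ⟨fun i => ?_, fun j => ?_⟩
      · rcases (le_lastIdx i).eq_or_lt with rfl | hi
        · exact Or.inl ⟨ha, ha', by linarith⟩
        · exact Or.inr ⟨hc i hi, by linarith [h1 i]⟩
      · rcases (Fin.zero_le j).eq_or_lt with rfl | hj
        · exact Or.inl ⟨hb, hb', by linarith⟩
        · exact Or.inr ⟨hd j hj, by linarith [h0 j]⟩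
    · refine ⟨fun i => Or.inr ⟨hc i, by linarith [h0 t, h1 i]⟩, fun j => ?_⟩
      rcases le_or_gt j t with hj | hj
      · exact Or.inl ⟨(ha j hj).1, (ha j hj).2, by linarith [hγ hj]⟩
      · exact Or.inr ⟨hb j hj, by linarith [hγ hj.le]⟩
  have kc : ∀ i, vertexMap γ α B i 0 0 ≤ -γ i - α ∧ vertexMap γ α B i 0 1 ≤ -γ i ∧
      vertexMap γ α B i 0 0 + vertexMap γ α B i 0 1 ≤ γ 0 - γ i := by
    intro i
    have := key.1 i
    cases e : B i 0 0 <;> cases e' : B i 0 1 <;>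
      simp [vertexMap, e, e'] at this ⊢ <;> linarith
  have kt : ∀ j, vertexMap γ α B j 1 0 ≤ γ j ∧ vertexMap γ α B j 1 1 ≤ γ j + α ∧
      vertexMap γ α B j 1 0 + vertexMap γ α B j 1 1 ≤ γ j - γ (lastIdx n) := by
    intro j
    have := key.2 j
    cases e : B j 1 0 <;> cases e' : B j 1 1 <;>
      simp [vertexMap, e, e'] at this ⊢ <;> linarith
  exact ⟨fun i j => by linarith [kc i, h0 j], fun i j => by linarith [kt j, h1 i],
    fun i j => by linarith [kc i, kt j], fun i j => by linarith [kc i, kt j]⟩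

theorem IsDualFeasible.exists_dot_le_dualProfile {γ : Fin n → ℝ} {u p : Fin n → Fin 2 → Fin 2 → ℝ}
    (hu : IsDualFeasible γ u) (hp0 : ∀ y d z, 0 ≤ p y d z) (hp : ∀ z, ∑ y, ∑ d, p y d z = 1) :
    ∃ α, dot u p ≤ dualProfile γ p α := by
  obtain ⟨i₀, hi₀⟩ := Finite.exists_max fun i => u i 0 0 + γ i
  obtain ⟨i₁, hi₁⟩ := Finite.exists_max fun i => u i 0 1 + γ i
  set s := u i₀ 0 0 + γ i₀
  set t := u i₁ 0 1 + γ i₁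
  refine ⟨-(s + t), ?_⟩
  have h0 := hp 0
  have h1 := hp 1
  simp only [Fin.sum_univ_two, Finset.sum_add_distrib] at h0 h1
  -- Moving `t` from the `z = 1` entries to the `z = 0` entries leaves the pairing unchanged, as
  -- both conditional laws have total mass one.
  have hshift : dot u p = ∑ i, ((u i 0 0 + t) * p i 0 0 + (u i 0 1 - t) * p i 0 1)
      + ∑ i, ((u i 1 0 + t) * p i 1 0 + (u i 1 1 - t) * p i 1 1) := by
    rw [dot_eq]
    simp only [add_mul, sub_mul, Finset.sum_add_distrib, Finset.sum_sub_distrib, ← Finset.mul_sum]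
    linear_combination (-t) * h0 + t * h1
  -- Here `x` and `y` are the reductions below the individual caps and `k` the excess they must
  -- cover; covering it costs at least `k` times the smaller weight.
  have aux : ∀ x y k a b : ℝ, 0 ≤ x → 0 ≤ y → k ≤ x + y → 0 ≤ a → 0 ≤ b →
      max k 0 * min a b ≤ x * a + y * b := by
    intro x y k a b hx hy hk ha hb
    calc max k 0 * min a b ≤ (x + y) * min a b :=
          mul_le_mul_of_nonneg_right (max_le hk (add_nonneg hx hy)) (le_min ha hb)
      _ = x * min a b + y * min a b := add_mul _ _ _
      _ ≤ x * a + y * b := add_le_add (mul_le_mul_of_nonneg_left (min_le_left _ _) hx)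
          (mul_le_mul_of_nonneg_left (min_le_right _ _) hy)
  rw [hshift, dualProfile]
  refine add_le_add (Finset.sum_le_sum fun i _ => ?_) (Finset.sum_le_sum fun j _ => ?_)
  · have := aux (s - (u i 0 0 + γ i)) (t - (u i 0 1 + γ i)) (-γ 0 - γ i - -(s + t)) _ _
      (sub_nonneg.2 (hi₀ i)) (sub_nonneg.2 (hi₁ i)) (by linarith [hu.control i 0])
      (hp0 i 0 0) (hp0 i 0 1)
    linarith
  · have := aux (γ j - u j 1 0 - t) (γ j - s - u j 1 1) (γ j + γ (lastIdx n) + -(s + t)) _ _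
      (by linarith [hu.cross' i₁ j]) (by linarith [hu.cross i₀ j])
      (by linarith [hu.treated (lastIdx n) j]) (hp0 j 1 0) (hp0 j 1 1)
    linarith

/-- The signature attaining `dualProfile γ p α`. -/
noncomputable def optimalSignature (γ : Fin n → ℝ) (p : Fin n → Fin 2 → Fin 2 → ℝ) (α : ℝ) :
    Fin n → Fin 2 → Fin 2 → Bool := fun i =>
  ![![decide (-γ 0 - γ i - α ≤ 0 ∨ ¬ p i 0 0 ≤ p i 0 1),
      decide (-γ 0 - γ i - α ≤ 0 ∨ p i 0 0 ≤ p i 0 1)],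
    ![decide (γ i + γ (lastIdx n) + α ≤ 0 ∨ ¬ p i 1 0 ≤ p i 1 1),
      decide (γ i + γ (lastIdx n) + α ≤ 0 ∨ p i 1 0 ≤ p i 1 1)]]

/-- Where the excess is positive, the signature switches off precisely the entry with the smaller
probability (the `z = 0` one in a tie), so the loss is excess times minimum. -/
theorem dot_vertexMap_optimalSignature (γ : Fin n → ℝ) (p : Fin n → Fin 2 → Fin 2 → ℝ) (α : ℝ) :
    dot (vertexMap γ α (optimalSignature γ p α)) p = dualProfile γ p α := by
  rw [dot_eq, dualProfile]
  congr 1 <;> refine Finset.sum_congr rfl fun i _ => ?_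
  · rcases le_or_gt (-γ 0 - γ i - α) 0 with h | h <;>
      rcases le_or_gt (p i 0 0) (p i 0 1) with h' | h'
    · simp [vertexMap, optimalSignature, h, h']; ring
    · simp [vertexMap, optimalSignature, h, h'.le, h']; ring
    · simp [vertexMap, optimalSignature, h.le, h.not_ge, h']; ring
    · simp [vertexMap, optimalSignature, h.le, h.not_ge, h'.le, h'.not_ge]; ring
  · rcases le_or_gt (γ i + γ (lastIdx n) + α) 0 with h | h <;>
      rcases le_or_gt (p i 1 0) (p i 1 1) with h' | h'
    · simp [vertexMap, optimalSignature, h, h']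
    · simp [vertexMap, optimalSignature, h, h'.le, h']
    · simp [vertexMap, optimalSignature, h.le, h.not_ge, h']; ring
    · simp [vertexMap, optimalSignature, h.le, h.not_ge, h'.le, h'.not_ge]; ring

end Vertices

/-! ### Maximizing the profile over the level. -/

section Profile

theorem piecewise_antitone {ι : Type*} [Fintype ι] (x m : ι → ℝ) {κ α β : ℝ} (hm : ∀ i, 0 ≤ m i)
    (hκ : κ + ∑ i, m i ≤ 0) (h : β ≤ α) :
    κ * α - ∑ i, max (x i - α) 0 * m i ≤ κ * β - ∑ i, max (x i - β) 0 * m i := by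
  have h1 : ∑ i, max (x i - β) 0 * m i ≤ ∑ i, max (x i - α) 0 * m i + (α - β) * ∑ i, m i := by
    rw [Finset.mul_sum, ← Finset.sum_add_distrib]
    refine Finset.sum_le_sum fun i _ => ?_
    rw [← add_mul]
    refine mul_le_mul_of_nonneg_right (max_le ?_ ?_) (hm i)
    · linarith [le_max_left (x i - α) 0]
    · linarith [le_max_right (x i - α) 0]
  nlinarith [mul_nonneg_of_nonpos_of_nonpos (sub_nonpos.2 h) hκ]

variable {n : ℕ} [NeZero n]

/-- Right of the central knot every treated-arm excess is nonnegative, so only the control-arm terms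
can bend; `dualProfile_of_le` is the mirror image in `-α`. -/
theorem dualProfile_of_ge {γ : Fin n → ℝ} (hγ : Monotone γ) (p : Fin n → Fin 2 → Fin 2 → ℝ)
    {α : ℝ} (hα : -γ 0 - γ (lastIdx n) ≤ α) :
    dualProfile γ p α =
      ∑ i, (-γ i * p i 0 0 - γ i * p i 0 1 + γ i * p i 1 0 + γ i * p i 1 1
        - (γ i + γ (lastIdx n)) * min (p i 1 0) (p i 1 1))
      + ((∑ i, p i 1 1 - ∑ i, p i 0 0 - ∑ i, min (p i 1 0) (p i 1 1)) * α
        - ∑ i, max (-γ 0 - γ i - α) 0 * min (p i 0 0) (p i 0 1)) := by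
  simp only [dualProfile, ← Finset.sum_sub_distrib, Finset.sum_mul, ← Finset.sum_add_distrib]
  refine Finset.sum_congr rfl fun i _ => ?_
  rw [max_eq_left (a := γ i + γ (lastIdx n) + α) (by linarith [hγ (Fin.zero_le i)])]
  ring

theorem dualProfile_of_le {γ : Fin n → ℝ} (hγ : Monotone γ) (p : Fin n → Fin 2 → Fin 2 → ℝ)
    {α : ℝ} (hα : α ≤ -γ 0 - γ (lastIdx n)) :
    dualProfile γ p α =
      ∑ i, (-γ i * p i 0 0 - γ i * p i 0 1 + γ i * p i 1 0 + γ i * p i 1 1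
        - (-γ 0 - γ i) * min (p i 0 0) (p i 0 1))
      + ((∑ i, p i 0 0 - ∑ i, p i 1 1 - ∑ i, min (p i 0 0) (p i 0 1)) * (-α)
        - ∑ i, max (γ i + γ (lastIdx n) - -α) 0 * min (p i 1 0) (p i 1 1)) := by
  simp only [dualProfile, ← Finset.sum_sub_distrib, Finset.sum_mul, ← Finset.sum_add_distrib]
  refine Finset.sum_congr rfl fun i _ => ?_
  rw [max_eq_left (a := -γ 0 - γ i - α) (by linarith [hγ (le_lastIdx i)]), sub_neg_eq_add]
  ring

variable {γ : Fin n → ℝ} {p : Fin n → Fin 2 → Fin 2 → ℝ}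

theorem dualProfile_le_maxVertex_of_admissible {α : ℝ}
    (h : AdmissibleWith γ (optimalSignature γ p α) α) : dualProfile γ p α ≤ maxVertex γ p :=
  (maxVertex_isGreatest γ p).2 ⟨_, ⟨_, _, h, rfl⟩, dot_vertexMap_optimalSignature γ p α⟩

theorem optimalSignature_isS2 (hγ : StrictMono γ) (p : Fin n → Fin 2 → Fin 2 → ℝ) :
    IsS2 (optimalSignature γ p (-γ 0 - γ (lastIdx n))) := by
  refine ⟨by simp [optimalSignature], fun i hi => ?_, fun j hj => ?_⟩
  · have : ¬ (-γ 0 - γ i - (-γ 0 - γ (lastIdx n)) ≤ 0) := by linarith [hγ hi]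
    by_cases h : p i 0 0 ≤ p i 0 1 <;> simp only [optimalSignature, this, h] <;> simp
  · have : ¬ (γ j + γ (lastIdx n) + (-γ 0 - γ (lastIdx n)) ≤ 0) := by linarith [hγ hj]
    by_cases h : p j 1 0 ≤ p j 1 1 <;> simp only [optimalSignature, this, h] <;> simp

theorem optimalSignature_isS1 (hγ : StrictMono γ) {t : Fin n} (ht : t < lastIdx n)
    (h1 : ∃ j, ¬ p j 1 0 ≤ p j 1 1) (h2 : ∃ j, p j 1 0 ≤ p j 1 1) :
    IsS1 t (optimalSignature γ p (-γ 0 - γ t)) := by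
  refine ⟨ht, fun i hi => ?_, fun i hi => ?_, fun j => ?_, ?_, ?_⟩
  · have : γ t ≤ γ i := hγ.monotone hi
    simp [optimalSignature, this]
  · have : ¬ (-γ 0 - γ i - (-γ 0 - γ t) ≤ 0) := by linarith [hγ hi]
    by_cases h : p i 0 0 ≤ p i 0 1 <;> simp only [optimalSignature, this, h] <;> simp
  · have : ¬ (γ j + γ (lastIdx n) + (-γ 0 - γ t) ≤ 0) := by
      linarith [hγ ht, hγ.monotone (Fin.zero_le j)]
    by_cases h : p j 1 0 ≤ p j 1 1 <;> simp only [optimalSignature, this, h] <;> simp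
  · exact h1.imp fun j hj => decide_eq_true (Or.inr hj)
  · exact h2.imp fun j hj => decide_eq_true (Or.inr hj)

theorem optimalSignature_isS3 (hγ : StrictMono γ) {t : Fin n} (ht : 0 < t)
    (h1 : ∃ j, ¬ p j 0 0 ≤ p j 0 1) (h2 : ∃ j, p j 0 0 ≤ p j 0 1) :
    IsS3 t (optimalSignature γ p (-γ t - γ (lastIdx n))) := by
  refine ⟨ht, fun i hi => ?_, fun i hi => ?_, fun j => ?_, ?_, ?_⟩
  · have : γ i ≤ γ t := hγ.monotone hi
    simp [optimalSignature, this]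
  · have : ¬ (γ i + γ (lastIdx n) + (-γ t - γ (lastIdx n)) ≤ 0) := by linarith [hγ hi]
    by_cases h : p i 1 0 ≤ p i 1 1 <;> simp only [optimalSignature, this, h] <;> simp
  · have : ¬ (-γ 0 - γ j - (-γ t - γ (lastIdx n)) ≤ 0) := by
      linarith [hγ ht, hγ.monotone (le_lastIdx j)]
    by_cases h : p j 0 0 ≤ p j 0 1 <;> simp only [optimalSignature, this, h] <;> simp
  · exact h1.imp fun j hj => decide_eq_true (Or.inr hj)
  · exact h2.imp fun j hj => decide_eq_true (Or.inr hj)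

/-- By independence `r i j 0 0 ≤ r i j 0 1 + r i j 1 1`; sum over `j`, compare with the trivial
bound by `p i 0 0`, then sum over `i`. This is the end slope condition for `α → -∞`;
`IsCoupling.sum_treated_le` serves `α → +∞`. -/
theorem IsCoupling.sum_control_le {n : ℕ} {p : Fin n → Fin 2 → Fin 2 → ℝ}
    {r : Fin n → Fin n → Fin 2 → Fin 2 → ℝ} (hr : IsCoupling p r) :
    ∑ i, p i 0 0 ≤ ∑ i, min (p i 0 0) (p i 0 1) + ∑ i, p i 1 1 := by
  simp only [← hr.treated]
  rw [Finset.sum_comm, ← Finset.sum_add_distrib]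
  refine Finset.sum_le_sum fun i _ => ?_
  rw [min_add, le_min_iff]
  constructor
  · linarith [Finset.sum_nonneg fun j (_ : j ∈ Finset.univ) => hr.nonneg i j 1 1]
  · rw [← hr.control, ← hr.control, ← Finset.sum_add_distrib]
    exact Finset.sum_le_sum fun j _ => by linarith [hr.nonneg i j 1 0, hr.indep i j]

theorem IsCoupling.sum_treated_le {n : ℕ} {p : Fin n → Fin 2 → Fin 2 → ℝ}
    {r : Fin n → Fin n → Fin 2 → Fin 2 → ℝ} (hr : IsCoupling p r) :
    ∑ i, p i 1 1 ≤ ∑ i, min (p i 1 0) (p i 1 1) + ∑ i, p i 0 0 := by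
  simp only [← hr.control]
  rw [Finset.sum_comm, ← Finset.sum_add_distrib]
  refine Finset.sum_le_sum fun j _ => ?_
  rw [min_add, le_min_iff]
  constructor
  · rw [← hr.treated, ← hr.treated, ← Finset.sum_add_distrib]
    exact Finset.sum_le_sum fun i _ => by linarith [hr.nonneg i j 0 1, hr.indep i j]
  · linarith [Finset.sum_nonneg fun i (_ : i ∈ Finset.univ) => hr.nonneg i j 0 0]

theorem IsCoupling.dualProfile_le_maxVertex {r : Fin n → Fin n → Fin 2 → Fin 2 → ℝ}
    (hγ : StrictMono γ) (hr : IsCoupling p r) (hp0 : ∀ y d z, 0 ≤ p y d z)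
    (hp : ∀ z, ∑ y, ∑ d, p y d z = 1) (α : ℝ) : dualProfile γ p α ≤ maxVertex γ p := by
  have hmid := dualProfile_le_maxVertex_of_admissible
    (Or.inr (Or.inl ⟨optimalSignature_isS2 hγ p, rfl⟩))
  have hm := hγ.monotone
  have hc := hr.sum_control_le
  have ht := hr.sum_treated_le
  have hp1 := hp 1
  have hp2 := hp 0
  simp only [Fin.sum_univ_two, Finset.sum_add_distrib] at hp1 hp2
  have m0 : ∀ d i, 0 ≤ min (p i d 0) (p i d 1) := fun d i => le_min (hp0 _ _ _) (hp0 _ _ _)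
  have ml : ∀ d, ∑ i, min (p i d 0) (p i d 1) ≤ ∑ i, p i d 0 := fun d =>
    Finset.sum_le_sum fun i _ => min_le_left _ _
  have mr : ∀ d, ∑ i, min (p i d 0) (p i d 1) ≤ ∑ i, p i d 1 := fun d =>
    Finset.sum_le_sum fun i _ => min_le_right _ _
  have el : ∀ d, (∀ i, p i d 0 ≤ p i d 1) → ∑ i, min (p i d 0) (p i d 1) = ∑ i, p i d 0 :=
    fun d h => Finset.sum_congr rfl fun i _ => min_eq_left (h i)
  have er : ∀ d, (∀ i, ¬ p i d 0 ≤ p i d 1) → ∑ i, min (p i d 0) (p i d 1) = ∑ i, p i d 1 :=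
    fun d h => Finset.sum_congr rfl fun i _ => min_eq_right (not_le.1 (h i)).le
  rcases le_total (-γ 0 - γ (lastIdx n)) α with hα | hα
  · obtain ⟨t, ht1, ht2⟩ := exists_knot_ge (fun i => -γ 0 - γ i)
      (fun i => min (p i 0 0) (p i 0 1))
      (∑ i, p i 1 1 - ∑ i, p i 0 0 - ∑ i, min (p i 1 0) (p i 1 1)) α (by linarith)
      (lastIdx n) hα
    have hle : dualProfile γ p α ≤ dualProfile γ p (-γ 0 - γ t) := by
      rw [dualProfile_of_ge hm p hα, dualProfile_of_ge hm p ht1]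
      linarith
    refine hle.trans ?_
    rcases (le_lastIdx t).eq_or_lt with rfl | htl
    · exact hmid
    by_cases h : (∃ j, ¬ p j 1 0 ≤ p j 1 1) ∧ ∃ j, p j 1 0 ≤ p j 1 1
    · exact dualProfile_le_maxVertex_of_admissible
        (Or.inl ⟨t, optimalSignature_isS1 hγ htl h.1 h.2, rfl⟩)
    -- One instrument value dominates throughout the treated arm, so the sum of minima is a full arm
    -- probability. The steepest slope right of the central knot is then nonpositive, and moving
    -- back to that knot loses nothing.
    · refine le_trans ?_ hmid
      rw [dualProfile_of_ge hm p ht1, dualProfile_of_ge hm p le_rfl]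
      refine add_le_add le_rfl (piecewise_antitone _ _ (m0 0) ?_ ht1)
      rw [not_and_or] at h
      push Not at h
      rcases h with h | h
      · linarith [el 1 h, mr 0]
      · linarith [er 1 fun i => not_le.2 (h i), ml 0]
  · obtain ⟨t, ht1, ht2⟩ := exists_knot_ge (fun i => γ i + γ (lastIdx n))
      (fun i => min (p i 1 0) (p i 1 1))
      (∑ i, p i 0 0 - ∑ i, p i 1 1 - ∑ i, min (p i 0 0) (p i 0 1)) (-α) (by linarith)
      0 (by linarith)
    have ht3 : -γ t - γ (lastIdx n) ≤ -γ 0 - γ (lastIdx n) := by linarith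
    have hle : dualProfile γ p α ≤ dualProfile γ p (-γ t - γ (lastIdx n)) := by
      rw [dualProfile_of_le hm p hα, dualProfile_of_le hm p ht3,
        show -(-γ t - γ (lastIdx n)) = γ t + γ (lastIdx n) by ring]
      linarith
    refine hle.trans ?_
    rcases (Fin.zero_le t).eq_or_lt with rfl | htl
    · exact hmid
    by_cases h : (∃ j, ¬ p j 0 0 ≤ p j 0 1) ∧ ∃ j, p j 0 0 ≤ p j 0 1
    · exact dualProfile_le_maxVertex_of_admissible
        (Or.inr (Or.inr ⟨t, optimalSignature_isS3 hγ htl h.1 h.2, rfl⟩))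
    · refine le_trans ?_ hmid
      rw [dualProfile_of_le hm p ht3, dualProfile_of_le hm p le_rfl]
      refine add_le_add le_rfl (piecewise_antitone _ _ (m0 1) ?_ (by linarith))
      rw [not_and_or] at h
      push Not at h
      rcases h with h | h
      · linarith [el 0 h, mr 1]
      · linarith [er 0 fun i => not_le.2 (h i), ml 1]

/-- The sharp lower bound for the effect of a coupling. -/
theorem IsCoupling.isLeast_effect {r : Fin n → Fin n → Fin 2 → Fin 2 → ℝ} (hγ : StrictMono γ)
    (hr : IsCoupling p r) (hp0 : ∀ y d z, 0 ≤ p y d z) (hp : ∀ z, ∑ y, ∑ d, p y d z = 1) :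
    IsLeast (effect γ '' {r | IsCoupling p r}) (maxVertex γ p) := by
  have hlow : ∀ r, IsCoupling p r → maxVertex γ p ≤ effect γ r := by
    intro r hr
    obtain ⟨_, ⟨B, α, hB, rfl⟩, h⟩ := (maxVertex_isGreatest γ p).1
    rw [← h]
    exact (hB.isDualFeasible hγ.monotone).dot_le hr
  refine ⟨?_, ?_⟩
  · refine hr.exists_effect_eq hp (hlow r hr) fun u hu => ?_
    obtain ⟨α, hα⟩ := hu.exists_dot_le_dualProfile hp0 hp
    exact hα.trans (hr.dualProfile_le_maxVertex hγ hp0 hp α)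
  · rintro _ ⟨r, hr, rfl⟩
    exact hlow r hr

end Profile

/-! ### Exchanging the treatment arms. -/

section Conjugation

variable {n : ℕ}

theorem IsCoupling.conj {p : Fin n → Fin 2 → Fin 2 → ℝ} {r : Fin n → Fin n → Fin 2 → Fin 2 → ℝ}
    (hr : IsCoupling p r) :
    IsCoupling (fun y d z => p y (1 - d) z) (fun i j d z => r j i (1 - d) z) where
  nonneg _ _ _ _ := hr.nonneg _ _ _ _
  control i z := hr.treated i z
  treated j z := hr.control j z
  indep i j := by
    have := hr.indep j i
    simp only [sub_zero, sub_self]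
    linarith

theorem effect_conj (γ : Fin n → ℝ) (r : Fin n → Fin n → Fin 2 → Fin 2 → ℝ) :
    effect γ (fun i j d z => r j i (1 - d) z) = -effect γ r := by
  rw [effect, Finset.sum_comm, effect]
  simp only [← Finset.sum_neg_distrib, sub_zero, sub_self]
  exact Finset.sum_congr rfl fun i _ => Finset.sum_congr rfl fun j _ => by ring

theorem condProbs_conjLaw (γ : Fin n → ℝ) (P : Measure (ℝ × Fin 2 × Fin 2)) :
    condProbs γ (conjLaw P) = fun y d z => condProbs γ P y (1 - d) z := by
  funext y d z
  have hf : Measurable fun w : ℝ × Fin 2 × Fin 2 => (w.1, 1 - w.2.1, w.2.2) := by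
    have : Measurable fun d : Fin 2 => 1 - d := measurable_of_countable _
    fun_prop
  have h1 : MeasurableSet {w : ℝ × Fin 2 × Fin 2 | w.2.2 = z} :=
    measurable_snd.snd (measurableSet_singleton z)
  have h2 : MeasurableSet {w : ℝ × Fin 2 × Fin 2 | w.1 = γ y ∧ w.2.1 = d} :=
    (measurable_fst (measurableSet_singleton (γ y))).inter
      (measurable_snd.fst (measurableSet_singleton d))
  have e : ∀ a : Fin 2, 1 - a = d ↔ a = 1 - d := by
    intro a
    constructor <;> rintro rfl <;> simp
  simp only [condProbs, measureReal_def, cond_apply h1, conjLaw, Measure.map_apply hf h1,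
    Measure.map_apply hf (h1.inter h2), Set.preimage_ofPred_eq, Set.preimage_inter, e]

end Conjugation

/-! ### From full data laws to couplings. -/

namespace FullData

variable {n : ℕ} {γ : Fin n → ℝ} (M : FullData.{u} γ)

theorem measurable_obs : Measurable fun ω => (M.Y ω, M.D ω, M.Z ω) :=
  M.measurable_Y.prodMk (M.measurable_D.prodMk M.measurable_Z)

theorem condProbs_observedLaw (y : Fin n) (d z : Fin 2) :
    condProbs γ M.observedLaw y d z = (M.μ[|M.Z ⁻¹' {z}]).real (M.Y ⁻¹' {γ y} ∩ M.D ⁻¹' {d}) := by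
  have h1 : MeasurableSet {w : ℝ × Fin 2 × Fin 2 | w.2.2 = z} :=
    measurable_snd.snd (measurableSet_singleton z)
  have h2 : MeasurableSet {w : ℝ × Fin 2 × Fin 2 | w.1 = γ y ∧ w.2.1 = d} :=
    (measurable_fst (measurableSet_singleton (γ y))).inter
      (measurable_snd.fst (measurableSet_singleton d))
  simp only [condProbs, measureReal_def, cond_apply h1, observedLaw,
    cond_apply (M.measurable_Z (measurableSet_singleton z)),
    Measure.map_apply M.measurable_obs h1, Measure.map_apply M.measurable_obs (h1.inter h2)]
  rfl

theorem observedLaw_snd_snd (z : Fin 2) :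
    M.observedLaw {w | w.2.2 = z} = M.μ (M.Z ⁻¹' {z}) :=
  Measure.map_apply M.measurable_obs (measurable_snd.snd (measurableSet_singleton z))

instance : IsProbabilityMeasure M.observedLaw :=
  Measure.isProbabilityMeasure_map M.measurable_obs.aemeasurable

theorem observedLaw_compl_range : M.observedLaw (Set.range γ ×ˢ Set.univ)ᶜ = 0 := by
  rw [observedLaw, Measure.map_apply M.measurable_obs
    ((Set.finite_range γ).measurableSet.prod MeasurableSet.univ).compl]
  convert measure_empty (μ := M.μ)
  ext ω
  simpa using M.Y_mem ω

/-- An observed law is determined by its atoms. -/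
theorem observedLaw_ext (M' : FullData.{v} γ)
    (h : ∀ y d z, M.observedLaw {(γ y, d, z)} = M'.observedLaw {(γ y, d, z)}) :
    M.observedLaw = M'.observedLaw := by
  have hF : (Set.range γ ×ˢ (Set.univ : Set (Fin 2 × Fin 2))).Finite :=
    (Set.finite_range γ).prod Set.finite_univ
  refine Measure.ext fun S _ => ?_
  rw [← measure_inter_add_sdiff S hF.measurableSet, ← measure_inter_add_sdiff S hF.measurableSet,
    measure_mono_null (Set.sdiff_subset_compl _ _) M.observedLaw_compl_range,
    measure_mono_null (Set.sdiff_subset_compl _ _) M'.observedLaw_compl_range, add_zero, add_zero]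
  have hS : (S ∩ Set.range γ ×ˢ Set.univ).Finite := hF.inter_of_right S
  rw [← hS.coe_toFinset, ← sum_measure_singleton, ← sum_measure_singleton]
  refine Finset.sum_congr rfl fun x hx => ?_
  obtain ⟨-, ⟨y, hy⟩, -⟩ := hS.mem_toFinset.1 hx
  obtain ⟨x1, d, z⟩ := x
  obtain rfl : γ y = x1 := hy
  exact h y d z

end FullData

theorem sum_measureReal_inter_preimage {Ω ι β : Type*} [MeasurableSpace Ω] [MeasurableSpace β]
    [MeasurableSingletonClass β] [Fintype ι] (ν : Measure Ω) [IsFiniteMeasure ν] {f : Ω → β}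
    (hf : Measurable f) {γ : ι → β} (hγ : Function.Injective γ) (hfγ : ∀ ω, f ω ∈ Set.range γ)
    {S : Set Ω} (hS : MeasurableSet S) : ∑ j, ν.real (S ∩ f ⁻¹' {γ j}) = ν.real S := by
  rw [← measureReal_biUnion_finset]
  · congr 1
    ext ω
    obtain ⟨j, hj⟩ := hfγ ω
    simp only [Finset.mem_univ, Set.iUnion_true, Set.mem_iUnion, Set.mem_inter_iff,
      Set.mem_preimage, Set.mem_singleton_iff, exists_and_left, and_iff_left_iff_imp]
    exact fun _ => ⟨j, hj.symm⟩
  · intro i _ j _ hij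
    refine Set.disjoint_left.2 fun ω h1 h2 => hij (hγ ?_)
    exact h1.2.symm.trans h2.2
  · exact fun j _ => hS.inter (hf (measurableSet_singleton _))

namespace FullData

variable {n : ℕ} {γ : Fin n → ℝ} (M : FullData.{u} γ)

theorem sum_condProbs_observedLaw (hγ : Function.Injective γ)
    (hZ : ∀ z, M.μ (M.Z ⁻¹' {z}) ≠ 0) (z : Fin 2) :
    ∑ y, ∑ d, condProbs γ M.observedLaw y d z = 1 := by
  have := cond_isProbabilityMeasure (hZ z)
  have h1 := sum_measureReal_inter_preimage (M.μ[|M.Z ⁻¹' {z}]) M.measurable_Y hγ M.Y_mem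
    MeasurableSet.univ
  rw [probReal_univ] at h1
  rw [← h1]
  refine Finset.sum_congr rfl fun y _ => ?_
  rw [Set.univ_inter, ← sum_measureReal_inter_preimage (M.μ[|M.Z ⁻¹' {z}]) M.measurable_D
    Function.injective_id (fun ω => ⟨_, rfl⟩) (M.measurable_Y (measurableSet_singleton (γ y)))]
  exact Finset.sum_congr rfl fun d _ => M.condProbs_observedLaw y d z

/-- The conditional joint law of `(Y^(0), Y^(1), D)` given `Z`. -/
noncomputable def coupling : Fin n → Fin n → Fin 2 → Fin 2 → ℝ := fun i j d z =>
  (M.μ[|M.Z ⁻¹' {z}]).real (M.potY 0 ⁻¹' {γ i} ∩ M.potY 1 ⁻¹' {γ j} ∩ M.D ⁻¹' {d})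

variable {M}

theorem coupling_add (i j : Fin n) (z : Fin 2) : M.coupling i j 0 z + M.coupling i j 1 z =
    (M.μ[|M.Z ⁻¹' {z}]).real (M.potY 0 ⁻¹' {γ i} ∩ M.potY 1 ⁻¹' {γ j}) := by
  have h := sum_measureReal_inter_preimage (M.μ[|M.Z ⁻¹' {z}]) M.measurable_D
    Function.injective_id (fun ω => ⟨_, rfl⟩)
    ((M.measurable_pot 0 0 (measurableSet_singleton (γ i))).inter
      (M.measurable_pot 1 0 (measurableSet_singleton (γ j))))
  rw [Fin.sum_univ_two] at h
  exact h

theorem IsJointIV.coupling_add_eq (hM : M.IsJointIV) (hZ : ∀ z, M.μ (M.Z ⁻¹' {z}) ≠ 0)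
    (i j : Fin n) (z : Fin 2) : M.coupling i j 0 z + M.coupling i j 1 z =
      M.μ.real (M.potY 0 ⁻¹' {γ i} ∩ M.potY 1 ⁻¹' {γ j}) := by
  have hind := indepFun_iff_measure_inter_preimage_eq_mul.1 hM.2.1 {z} ({γ i} ×ˢ {γ j})
    (measurableSet_singleton z) ((measurableSet_singleton _).prod (measurableSet_singleton _))
  have hs : (fun ω => (M.potY 0 ω, M.potY 1 ω)) ⁻¹' ({γ i} ×ˢ {γ j})
      = M.potY 0 ⁻¹' {γ i} ∩ M.potY 1 ⁻¹' {γ j} := rfl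
  rw [hs] at hind
  rw [coupling_add, measureReal_def, cond_apply (M.measurable_Z (measurableSet_singleton z)), hind,
    ← mul_assoc, ENNReal.inv_mul_cancel (hZ z) (measure_ne_top _ _), one_mul, measureReal_def]

theorem IsJointIV.isCoupling (hM : M.IsJointIV) (hγ : Function.Injective γ)
    (hZ : ∀ z, M.μ (M.Z ⁻¹' {z}) ≠ 0) : IsCoupling (condProbs γ M.observedLaw) M.coupling where
  nonneg _ _ _ _ := measureReal_nonneg
  control i z := by
    rw [M.condProbs_observedLaw]
    -- Consistency passes to the conditional measure, where `Y` and `Y^(0)` agree almost surely on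
    -- `D = 0`; summing out `Y^(1)` gives the margin.
    have hae := (cond_absolutelyContinuous (s := M.Z ⁻¹' {z})).ae_le hM.2.2
    have h := sum_measureReal_inter_preimage (M.μ[|M.Z ⁻¹' {z}]) (M.measurable_pot 1 0) hγ
      (M.pot_mem 1 0) ((M.measurable_pot 0 0 (measurableSet_singleton (γ i))).inter
        (M.measurable_D (measurableSet_singleton 0)))
    have h' : (M.μ[|M.Z ⁻¹' {z}]).real (M.pot 0 0 ⁻¹' {γ i} ∩ M.D ⁻¹' {0})
        = (M.μ[|M.Z ⁻¹' {z}]).real (M.Y ⁻¹' {γ i} ∩ M.D ⁻¹' {0}) := by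
      refine measureReal_congr ?_
      filter_upwards [hae] with ω hω
      refine propext (and_congr_left fun (hD : M.D ω = 0) => ?_)
      simp only [hD, Fin.val_zero, Nat.cast_zero, sub_zero, one_mul, zero_mul, add_zero] at hω
      exact (congrArg (· = γ i) hω.symm).to_iff
    rw [← h', ← h]
    refine Finset.sum_congr rfl fun j _ => ?_
    rw [Set.inter_right_comm]
    rfl
  treated j z := by
    rw [M.condProbs_observedLaw]
    have hae := (cond_absolutelyContinuous (s := M.Z ⁻¹' {z})).ae_le hM.2.2
    have h := sum_measureReal_inter_preimage (M.μ[|M.Z ⁻¹' {z}]) (M.measurable_pot 0 0) hγ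
      (M.pot_mem 0 0) ((M.measurable_pot 1 0 (measurableSet_singleton (γ j))).inter
        (M.measurable_D (measurableSet_singleton 1)))
    have h' : (M.μ[|M.Z ⁻¹' {z}]).real (M.pot 1 0 ⁻¹' {γ j} ∩ M.D ⁻¹' {1})
        = (M.μ[|M.Z ⁻¹' {z}]).real (M.Y ⁻¹' {γ j} ∩ M.D ⁻¹' {1}) := by
      refine measureReal_congr ?_
      filter_upwards [hae] with ω hω
      refine propext (and_congr_left fun (hD : M.D ω = 1) => ?_)
      simp only [hD, Fin.val_one, Nat.cast_one, sub_self, one_mul, zero_mul, zero_add] at hω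
      exact (congrArg (· = γ j) hω.symm).to_iff
    rw [← h', ← h]
    refine Finset.sum_congr rfl fun i _ => ?_
    rw [Set.inter_right_comm, Set.inter_comm (M.pot 1 0 ⁻¹' _)]
    rfl
  indep i j := by rw [hM.coupling_add_eq hZ, hM.coupling_add_eq hZ]

theorem IsJointIV.effect_coupling (hM : M.IsJointIV) (hγ : Function.Injective γ)
    (hZ : ∀ z, M.μ (M.Z ⁻¹' {z}) ≠ 0) : effect γ M.coupling = M.ate := by
  classical
  have hmeas : ∀ i j, MeasurableSet (M.potY 0 ⁻¹' {γ i} ∩ M.potY 1 ⁻¹' {γ j}) := fun i j =>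
    (M.measurable_pot 0 0 (measurableSet_singleton (γ i))).inter
      (M.measurable_pot 1 0 (measurableSet_singleton (γ j)))
  have hpt : ∀ ω, M.potY 1 ω - M.potY 0 ω = ∑ i, ∑ j,
      (M.potY 0 ⁻¹' {γ i} ∩ M.potY 1 ⁻¹' {γ j}).indicator (fun _ => γ j - γ i) ω := by
    intro ω
    obtain ⟨i, hi⟩ := M.pot_mem 0 0 ω
    obtain ⟨j, hj⟩ := M.pot_mem 1 0 ω
    simp [Set.indicator_apply, potY, ← hi, ← hj, hγ.eq_iff, ite_and]
  rw [ate]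
  simp_rw [hpt]
  rw [integral_finsetSum]
  · refine Finset.sum_congr rfl fun i _ => ?_
    rw [integral_finsetSum]
    · refine Finset.sum_congr rfl fun j _ => ?_
      rw [integral_indicator_const _ (hmeas i j), hM.coupling_add_eq hZ, smul_eq_mul, mul_comm]
    · exact fun j _ => (integrable_const _).indicator (hmeas i j)
  · exact fun i _ => integrable_finsetSum _ fun j _ => (integrable_const _).indicator (hmeas i j)

end FullData

/-! ### Realizing couplings by full data laws on a finite space. -/

/-- The measure on a finite type with given weights. -/
noncomputable def weightMeasure {α : Type*} [Fintype α] [MeasurableSpace α] (w : α → ℝ) :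
    Measure α :=
  ∑ x, ENNReal.ofReal (w x) • Measure.dirac x

theorem weightMeasure_apply {α : Type*} [Fintype α] [MeasurableSpace α] {w : α → ℝ}
    (hw : ∀ x, 0 ≤ w x) {S : Set α} (hS : MeasurableSet S) :
    weightMeasure w S = ENNReal.ofReal (∑ x, S.indicator w x) := by
  classical
  rw [ENNReal.ofReal_sum_of_nonneg fun x _ => Set.indicator_nonneg (fun x _ => hw x) x,
    weightMeasure, Measure.finsetSum_apply]
  refine Finset.sum_congr rfl fun x _ => ?_
  by_cases h : x ∈ S <;> simp [Measure.dirac_apply' _ hS, h]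

section Realization

variable {n : ℕ}

theorem IsCoupling.sum_eq {p : Fin n → Fin 2 → Fin 2 → ℝ}
    {r : Fin n → Fin n → Fin 2 → Fin 2 → ℝ} (hr : IsCoupling p r) (z : Fin 2) :
    ∑ i, ∑ j, (r i j 0 z + r i j 1 z) = ∑ y, ∑ d, p y d z := by
  simp only [Fin.sum_univ_two, Finset.sum_add_distrib, ← hr.control, ← hr.treated]
  rw [Finset.sum_comm (f := fun i j => r i j 1 z)]

/-- The weights on `Fin n × Fin n × Fin 2 × Fin 2` given by a marginal law of the instrument and a
coupling. -/
def jointWeight (π : Fin 2 → ℝ) (r : Fin n → Fin n → Fin 2 → Fin 2 → ℝ) :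
    Fin n × Fin n × Fin 2 × Fin 2 → ℝ :=
  fun x => π x.2.2.2 * r x.1 x.2.1 x.2.2.1 x.2.2.2

/-- Instrument events and potential outcome events have product weight. -/
theorem sum_indicator_jointWeight {π : Fin 2 → ℝ} {p : Fin n → Fin 2 → Fin 2 → ℝ}
    {r : Fin n → Fin n → Fin 2 → Fin 2 → ℝ} (hr : IsCoupling p r) (s : Set (Fin 2))
    (T : Set (Fin n × Fin n)) :
    ∑ x, {x : Fin n × Fin n × Fin 2 × Fin 2 | x.2.2.2 ∈ s ∧ (x.1, x.2.1) ∈ T}.indicator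
      (jointWeight π r) x = (∑ z, s.indicator π z) *
        ∑ a, T.indicator (fun a => r a.1 a.2 0 0 + r a.1 a.2 1 0) a := by
  classical
  simp only [Fintype.sum_prod_type, Finset.mul_sum]
  refine Finset.sum_congr rfl fun i _ => Finset.sum_congr rfl fun j _ => ?_
  have h := hr.indep i j
  -- The right side uses the `z = 0` mass of `(i, j)`, so the independence constraint is needed
  -- exactly when `1 ∈ s`.
  by_cases hT : (i, j) ∈ T <;> by_cases h0 : (0 : Fin 2) ∈ s <;> by_cases h1 : (1 : Fin 2) ∈ s <;>
    simp [Fin.sum_univ_two, Set.indicator_apply, jointWeight, hT, h0, h1]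
  · linear_combination (-π 1) * h
  · ring
  · linear_combination (-π 1) * h

/-- Every coupling of the conditional observed probabilities is realized by a full data law with
the same observed law. -/
theorem IsCoupling.exists_fullData {γ : Fin n → ℝ} (hγ : Function.Injective γ)
    (M : FullData.{u} γ) {r : Fin n → Fin n → Fin 2 → Fin 2 → ℝ}
    (hr : IsCoupling (condProbs γ M.observedLaw) r)
    (hp : ∀ z, ∑ y, ∑ d, condProbs γ M.observedLaw y d z = 1) :
    ∃ M' : FullData.{0} γ, M'.IsJointIV ∧ M'.observedLaw = M.observedLaw ∧
      M'.ate = effect γ r := by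
  classical
  -- Conditional probabilities do not determine the law of the instrument, so its marginal is copied
  -- from `M`.
  set π : Fin 2 → ℝ := fun z => M.μ.real (M.Z ⁻¹' {z}) with hπ
  have hπ0 : ∀ z, 0 ≤ π z := fun z => measureReal_nonneg
  have hπ1 : ∑ z, π z = 1 := by
    have := sum_measureReal_inter_preimage M.μ M.measurable_Z Function.injective_id
      (fun ω => ⟨_, rfl⟩) MeasurableSet.univ
    simpa using this
  have hw : ∀ x, 0 ≤ jointWeight π r x := fun x => mul_nonneg (hπ0 _) (hr.nonneg _ _ _ _)
  have hq1 : ∑ a : Fin n × Fin n, (r a.1 a.2 0 0 + r a.1 a.2 1 0) = 1 := by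
    rw [Fintype.sum_prod_type, hr.sum_eq, hp]
  have hone : ∑ x, jointWeight π r x = 1 := by
    have := sum_indicator_jointWeight (π := π) hr Set.univ Set.univ
    simpa [hq1, hπ1] using this
  let _ : MeasurableSpace (Fin n × Fin n × Fin 2 × Fin 2) := ⊤
  have : IsProbabilityMeasure (weightMeasure (jointWeight π r)) := ⟨by
    rw [weightMeasure_apply hw MeasurableSet.univ]
    simp [hone]⟩
  let M' : FullData.{0} γ :=
    { Ω := Fin n × Fin n × Fin 2 × Fin 2
      mΩ := ⊤
      μ := weightMeasure (jointWeight π r)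
      isProb := this
      pot := fun d _ x => if d = 0 then γ x.1 else γ x.2.1
      D := fun x => x.2.2.1
      Z := fun x => x.2.2.2
      Y := fun x => if x.2.2.1 = 0 then γ x.1 else γ x.2.1
      measurable_pot := fun _ _ => measurable_from_top
      measurable_D := measurable_from_top
      measurable_Z := measurable_from_top
      measurable_Y := measurable_from_top
      pot_mem := fun d z x => by split_ifs <;> exact ⟨_, rfl⟩
      Y_mem := fun x => by split_ifs <;> exact ⟨_, rfl⟩ }
  refine ⟨M', ⟨fun d z z' => Filter.EventuallyEq.rfl, ?_, ?_⟩, ?_, ?_⟩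
  · refine indepFun_iff_measure_inter_preimage_eq_mul.2 fun s T _ _ => ?_
    let T' : Set (Fin n × Fin n) := {a | (γ a.1, γ a.2) ∈ T}
    have e1 : M'.Z ⁻¹' s ∩ (fun ω => (M'.potY 0 ω, M'.potY 1 ω)) ⁻¹' T
        = {x | x.2.2.2 ∈ s ∧ (x.1, x.2.1) ∈ T'} := rfl
    have e2 : M'.Z ⁻¹' s = {x | x.2.2.2 ∈ s ∧ (x.1, x.2.1) ∈ (Set.univ : Set (Fin n × Fin n))} := by
      ext x
      simp [M']
    have e3 : (fun ω => (M'.potY 0 ω, M'.potY 1 ω)) ⁻¹' T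
        = {x | x.2.2.2 ∈ (Set.univ : Set (Fin 2)) ∧ (x.1, x.2.1) ∈ T'} := by
      ext x
      simp [M', T', FullData.potY]
    rw [e1, e2, e3]
    change weightMeasure (jointWeight π r) _ =
      weightMeasure (jointWeight π r) _ * weightMeasure (jointWeight π r) _
    rw [weightMeasure_apply hw trivial, weightMeasure_apply hw trivial,
      weightMeasure_apply hw trivial, sum_indicator_jointWeight hr, sum_indicator_jointWeight hr,
      sum_indicator_jointWeight hr, ← ENNReal.ofReal_mul]
    · simp [hq1, hπ1]
    · simp only [Set.indicator_univ, hq1, mul_one]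
      exact Finset.sum_nonneg fun z _ => Set.indicator_nonneg (fun z _ => hπ0 z) z
  · refine Filter.Eventually.of_forall fun x => ?_
    change (if x.2.2.1 = 0 then γ x.1 else γ x.2.1) = (1 - ((x.2.2.1 : ℕ) : ℝ)) * γ x.1
      + ((x.2.2.1 : ℕ) : ℝ) * γ x.2.1
    obtain ⟨i, j, d, z⟩ := x
    fin_cases d <;> simp
  · refine FullData.observedLaw_ext _ _ fun y d z => ?_
    rw [FullData.observedLaw, Measure.map_apply M'.measurable_obs (measurableSet_singleton _),
      FullData.observedLaw, Measure.map_apply M.measurable_obs (measurableSet_singleton _)]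
    have h1 : M.μ ((fun ω => (M.Y ω, M.D ω, M.Z ω)) ⁻¹' {(γ y, d, z)})
        = ENNReal.ofReal (π z * condProbs γ M.observedLaw y d z) := by
      simp only [M.condProbs_observedLaw, hπ, measureReal_def]
      rw [← ENNReal.toReal_mul, ENNReal.ofReal_toReal (by finiteness),
        mul_comm, cond_mul_eq_inter (M.measurable_Z (measurableSet_singleton z))]
      congr 1
      ext ω
      simp
      tauto
    rw [h1]
    change weightMeasure (jointWeight π r) _ = _
    rw [weightMeasure_apply hw trivial]
    congr 1
    have h2 : ∀ x, ((fun ω => (M'.Y ω, M'.D ω, M'.Z ω)) ⁻¹' {(γ y, d, z)}).indicator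
        (jointWeight π r) x = if (if x.2.2.1 = 0 then x.1 else x.2.1) = y ∧ x.2.2.1 = d ∧
          x.2.2.2 = z then jointWeight π r x else 0 := by
      intro x
      rw [Set.indicator_apply]
      refine if_congr ?_ rfl rfl
      simp only [Set.mem_preimage, Set.mem_singleton_iff, Prod.mk.injEq, M', ← apply_ite γ,
        hγ.eq_iff]
    have hd : d = 0 ∨ d = 1 := by fin_cases d <;> simp
    have hz : z = 0 ∨ z = 1 := by fin_cases z <;> simp
    rcases hd with rfl | rfl
    · rw [← hr.control, Finset.mul_sum]
      rcases hz with rfl | rfl <;>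
        simp [h2, Fintype.sum_prod_type, Fin.sum_univ_two, jointWeight, Finset.sum_ite_irrel]
    · rw [← hr.treated, Finset.mul_sum]
      rcases hz with rfl | rfl <;>
        simp [h2, Fintype.sum_prod_type, Fin.sum_univ_two, jointWeight]
  · have h1 : M'.ate = ∑ x : Fin n × Fin n × Fin 2 × Fin 2,
        jointWeight π r x * (γ x.2.1 - γ x.1) := by
      have hs : @MeasurableSingletonClass (Fin n × Fin n × Fin 2 × Fin 2) ⊤ := ⟨fun _ => trivial⟩
      change ∫ x : Fin n × Fin n × Fin 2 × Fin 2, (γ x.2.1 - γ x.1)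
        ∂(weightMeasure (jointWeight π r)) = _
      rw [integral_fintype .of_finite]
      refine Finset.sum_congr rfl fun x _ => ?_
      rw [measureReal_def, weightMeasure_apply hw trivial, smul_eq_mul]
      simp [Set.indicator_apply, ENNReal.toReal_ofReal (hw x)]
    rw [h1, effect, Fintype.sum_prod_type]
    refine Finset.sum_congr rfl fun i _ => ?_
    rw [Fintype.sum_prod_type]
    refine Finset.sum_congr rfl fun j _ => ?_
    rw [Fin.sum_univ_two] at hπ1
    simp only [Fintype.sum_prod_type, Fin.sum_univ_two, jointWeight]
    linear_combination (-(π 1) * (γ j - γ i)) * hr.indep i j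
      + (γ j - γ i) * (r i j 0 0 + r i j 1 0) * hπ1

end Realization

end BinaryIV

/-! ### Validity and sharpness of both bounds. -/

theorem mainTheorem8 (n : ℕ) [NeZero n] (γ : Fin n → ℝ) (hγ : StrictMono γ)
    (P : Measure (ℝ × Fin 2 × Fin 2)) (hP : ∀ z : Fin 2, P {w | w.2.2 = z} ≠ 0) :
    -- validity
    (∀ M : BinaryIV.FullData.{u} γ, M.IsJointIV → M.observedLaw = P →
      BinaryIV.lowerBound γ P ≤ M.ate ∧ M.ate ≤ BinaryIV.upperBound γ P) ∧
    -- sharpness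
    ((∃ M : BinaryIV.FullData.{u} γ, M.IsJointIV ∧ M.observedLaw = P) →
      (∃ M : BinaryIV.FullData.{0} γ, M.IsJointIV ∧ M.observedLaw = P ∧
        M.ate = BinaryIV.lowerBound γ P) ∧
      (∃ M : BinaryIV.FullData.{0} γ, M.IsJointIV ∧ M.observedLaw = P ∧
        M.ate = BinaryIV.upperBound γ P)) := by
  have key : ∀ M : BinaryIV.FullData.{u} γ, M.IsJointIV → M.observedLaw = P →
      BinaryIV.IsCoupling (BinaryIV.condProbs γ P) M.coupling ∧
      BinaryIV.effect γ M.coupling = M.ate ∧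
      (∀ z, ∑ y, ∑ d, BinaryIV.condProbs γ P y d z = 1) ∧
      IsLeast (BinaryIV.effect γ '' {r | BinaryIV.IsCoupling (BinaryIV.condProbs γ P) r})
        (BinaryIV.lowerBound γ P) ∧
      IsLeast (BinaryIV.effect γ ''
        {r | BinaryIV.IsCoupling (BinaryIV.condProbs γ (BinaryIV.conjLaw P)) r})
        (-BinaryIV.upperBound γ P) := by
    rintro M hM rfl
    have hZ : ∀ z, M.μ (M.Z ⁻¹' {z}) ≠ 0 := fun z => M.observedLaw_snd_snd z ▸ hP z
    have hc := hM.isCoupling hγ.injective hZ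
    have hp := M.sum_condProbs_observedLaw hγ.injective hZ
    refine ⟨hc, hM.effect_coupling hγ.injective hZ, hp,
      hc.isLeast_effect hγ (fun _ _ _ => measureReal_nonneg) hp, ?_⟩
    rw [BinaryIV.upperBound, neg_neg, BinaryIV.condProbs_conjLaw]
    refine hc.conj.isLeast_effect hγ (fun _ _ _ => measureReal_nonneg) fun z => ?_
    rw [← hp z]
    refine Finset.sum_congr rfl fun y _ => ?_
    simp [Fin.sum_univ_two, add_comm]
  refine ⟨fun M hM hMP => ?_, ?_⟩
  · obtain ⟨hc, he, -, hl, hu⟩ := key M hM hMP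
    rw [← he]
    refine ⟨hl.2 ⟨_, hc, rfl⟩, ?_⟩
    rw [BinaryIV.condProbs_conjLaw] at hu
    have := hu.2 ⟨_, hc.conj, rfl⟩
    rw [BinaryIV.effect_conj] at this
    linarith
  · rintro ⟨M, hM, hMP⟩
    obtain ⟨-, -, hp, hl, hu⟩ := key M hM hMP
    subst hMP
    refine ⟨?_, ?_⟩
    · obtain ⟨r, hr, hrl⟩ := hl.1
      rw [← hrl]
      exact hr.exists_fullData hγ.injective M hp
    · obtain ⟨r, hr, hru⟩ := hu.1
      -- Conjugation is an involution: a minimizer for the conjugate law becomes a coupling for `P`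
      -- with the opposite effect, hence a maximizer.
      have hr' := BinaryIV.IsCoupling.conj hr
      simp only [BinaryIV.condProbs_conjLaw, sub_sub_cancel] at hr'
      obtain ⟨M', h1, h2, h3⟩ := hr'.exists_fullData hγ.injective M hp
      refine ⟨M', h1, h2, ?_⟩
      rw [h3, BinaryIV.effect_conj, hru, neg_neg]
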